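/- Let $N\ge 2$, $d$ be integers, $c\in\{0,N\}$, and put $a=r=1$ if $c=0$, and $a=N$, $r=N-1$ if $c=N$. All random vectors are $\mathbb{R}^d$-valued on one probability space and all matrices are real $d\times d$; $'$ denotes transposition. A sequence is zero-mean nonsingular Gaussian (ZMNG) if its terms are jointly Gaussian with mean zero and the covariance matrix of the whole sequence is nonsingular. It is Markov if, given the state at any time $j$, its past (times $<j$) and its future (times $>j$) are independent. It is reciprocal if, given the states at any two times $j<l$, the segment inside $(j,l)$ is independent of the two segments outside $[j,l]$. Let $(y_k)_{k\in[0,N]\setminus\{c\}}$ be a ZMNG Markov sequence satisfying, almost surely, $$y_k=U_{k,k-1}y_{k-1}+e_k,\qquad k\in[1,N]\setminus\{a\},$$ with $e_0=y_0$ if $c=N$ and $e_1=y_1$ if $c=0$, where $(e_k)_{k\in[0,N]\setminus\{c\}}$ is a ZMNG sequence of pairwise uncorrelated vectors with covariances $U_k=\mathrm{Cov}(e_k)$. Let $x_c$ be a ZMNG vector that is jointly Gaussian and uncorrelated with $(y_k)_{k\in[0,N]\setminus\{c\}}$. Let $\Gamma_k$, $k\in[0,N]\setminus\{c\}$, be matrices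 and let $$x_k=y_k+\Gamma_kx_c\quad\text{almost surely},\qquad k\in[0,N]\setminus\{c\}.$$ Then $(x_k)_{k\in[0,N]}$ is reciprocal if and only if $$U_k^{-1}(\Gamma_k-U_{k,k-1}\Gamma_{k-1})=U_{k+1,k}'\,U_{k+1}^{-1}(\Gamma_{k+1}-U_{k+1,k}\Gamma_k)\qquad\text{for all }k\in[1,N-1]\setminus\{r\}.\tag{1}$$ Moreover, $(x_k)_{k\in[0,N]}$ is Markov if and only if (1) holds and, in addition, $$U_0^{-1}\Gamma_0=U_{1,0}'\,U_1^{-1}(\Gamma_1-U_{1,0}\Gamma_0)\quad\text{if }c=N,\qquad \Gamma_N-U_{N,N-1}\Gamma_{N-1}=0\quad\text{if }c=0.$$ -/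

import Mathlib

open MeasureTheory ProbabilityTheory

/-- The σ-algebra generated by the random vectors `x i`, `i ∈ S`. -/
abbrev sigmaGen {Ω E : Type*} [MeasurableSpace E] (x : ℕ → Ω → E) (S : Set ℕ) :
    MeasurableSpace Ω :=
  ⨆ i ∈ S, MeasurableSpace.comap (x i) inferInstance

/-- The σ-algebras `m₁` and `m₂` are conditionally independent given `m`:
`P(A ∩ B | m) = P(A | m) P(B | m)` almost surely for all `A ∈ m₁`, `B ∈ m₂`.
This makes sense on every probability space; on a standard Borel space it is Mathlib's
`CondIndep`, see `condIndepGiven_iff_condIndep`. -/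
def CondIndepGiven {Ω : Type*} (m m₁ m₂ : MeasurableSpace Ω) {mΩ : MeasurableSpace Ω}
    (μ : Measure Ω) : Prop :=
  ∀ A B : Set Ω, MeasurableSet[m₁] A → MeasurableSet[m₂] B →
    μ⟦A ∩ B | m⟧ =ᵐ[μ] μ⟦A | m⟧ * μ⟦B | m⟧

theorem condIndepGiven_iff_condIndep {Ω : Type*} (m m₁ m₂ : MeasurableSpace Ω)
    {mΩ : MeasurableSpace Ω} [StandardBorelSpace Ω] (μ : Measure Ω) [IsFiniteMeasure μ]
    (hm : m ≤ mΩ) (hm₁ : m₁ ≤ mΩ) (hm₂ : m₂ ≤ mΩ) :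
    CondIndepGiven m m₁ m₂ μ ↔ CondIndep m m₁ m₂ hm μ := by
  rw [condIndep_iff m m₁ m₂ hm hm₁ hm₂]
  rfl

/-- The sequence `(x k)`, `k ∈ T`, is Markov: given the present `x j`, the past
`(x i)`, `i < j`, and the future `(x i)`, `i > j`, are independent. -/
def IsMarkovSeq {Ω E : Type*} [MeasurableSpace Ω] [MeasurableSpace E] (μ : Measure Ω)
    (T : Finset ℕ) (x : ℕ → Ω → E) : Prop :=
  ∀ j ∈ T, CondIndepGiven (sigmaGen x {j})
    (sigmaGen x {i | i ∈ T ∧ i < j}) (sigmaGen x {i | i ∈ T ∧ j < i}) μ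

/-- The sequence `(x k)`, `k ∈ T`, is reciprocal: given the states at any two times `j < l`,
the segment inside `(j, l)` is independent of the two segments outside `[j, l]`. -/
def IsReciprocalSeq {Ω E : Type*} [MeasurableSpace Ω] [MeasurableSpace E] (μ : Measure Ω)
    (T : Finset ℕ) (x : ℕ → Ω → E) : Prop :=
  ∀ j ∈ T, ∀ l ∈ T, j < l → CondIndepGiven (sigmaGen x {j, l})
    (sigmaGen x {i | i ∈ T ∧ j < i ∧ i < l}) (sigmaGen x {i | i ∈ T ∧ (i < j ∨ l < i)}) μ

/-- The cross-covariance matrix `Cov(X, Y)` of two random vectors. -/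
noncomputable def crossCov {Ω ι κ : Type*} [MeasurableSpace Ω] (μ : Measure Ω)
    (X : Ω → ι → ℝ) (Y : Ω → κ → ℝ) : Matrix ι κ ℝ :=
  Matrix.of fun i j => cov[fun ω => X ω i, fun ω => Y ω j; μ]

/-- The covariance matrix of the stacked vector of all coordinates of `x k`, `k ∈ T`. -/
noncomputable def seqCov {Ω : Type*} [MeasurableSpace Ω] (μ : Measure Ω) {d : ℕ}
    (T : Finset ℕ) (x : ℕ → Ω → Fin d → ℝ) : Matrix (T × Fin d) (T × Fin d) ℝ :=
  crossCov μ (fun ω p => x p.1 ω p.2) (fun ω p => x p.1 ω p.2)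

/-- `(x k)`, `k ∈ T`, is a zero-mean nonsingular Gaussian sequence: the vectors `x k` are jointly
Gaussian, have mean zero, and the covariance matrix of the whole sequence is nonsingular. -/
structure IsZMNG {Ω : Type*} [MeasurableSpace Ω] (μ : Measure Ω) {d : ℕ}
    (T : Finset ℕ) (x : ℕ → Ω → Fin d → ℝ) : Prop where
  gaussian : HasGaussianLaw (fun ω (k : T) => x k ω) μ
  mean_zero : ∀ k ∈ T, ∫ ω, x k ω ∂μ = 0
  nonsingular : (seqCov μ T x).det ≠ 0

/-- `(e k)`, `k ∈ T`, is a zero-mean white nonsingular Gaussian sequence with covariances `U k`. -/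
structure IsWhiteZMNG {Ω : Type*} [MeasurableSpace Ω] (μ : Measure Ω) {d : ℕ}
    (T : Finset ℕ) (e : ℕ → Ω → Fin d → ℝ) (U : ℕ → Matrix (Fin d) (Fin d) ℝ) : Prop where
  zmng : IsZMNG μ T e
  white : ∀ i ∈ T, ∀ j ∈ T, i ≠ j → crossCov μ (e i) (e j) = 0
  cov_eq : ∀ k ∈ T, crossCov μ (e k) (e k) = U k

/-! ### Conditional independence through set integrals -/

section CondIndep

variable {Ω : Type*} {m m₁ m₂ mΩ : MeasurableSpace Ω} {μ : Measure Ω}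

/-! For a nonsingular Gaussian vector, two blocks are conditionally independent given all the
remaining coordinates exactly when the corresponding block of the precision matrix vanishes
(`condIndepGiven_coordAlg_iff`). Hence Markov means block tridiagonal, and reciprocal means the same
except that the corner block (0, N) is free.

The precision matrix is explicit. With `D m = Γ m - F m * Γ (m - 1)`, where `F m` is the transition
matrix, or 0 at the initial time of `y`, one has `x m - D m x_c - F m x (m - 1) = e m`. Thus a
linear map B with identity diagonal blocks turns `x` into the white sequence formed by `x_c` and the
`e m`, and the precision matrix is Bᵀ Δ⁻¹ B (`precision_of_whitening`, `precision_of_model`).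

Row m of B only involves the times m, m - 1 and c, so blocks away from c and from the tridiagonal
band vanish automatically (`precisionBlock_eq_zero`). What remains is column c: its block at k is
`-(Δ k)⁻¹ D k + F (k+1)ᵀ (Δ (k+1))⁻¹ D (k+1)` (`precisionBlock_right`), without the second term if
there is no later innovation. Its vanishing at every k that is not a cyclic neighbour of c is (1);
its vanishing at the corner is the extra Markov condition. -/

theorem MeasurableSpace.sup_eq_generateFrom_inter :
    m₁ ⊔ m₂ = MeasurableSpace.generateFrom
      {u | ∃ s t, MeasurableSet[m₁] s ∧ MeasurableSet[m₂] t ∧ s ∩ t = u} := by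
  refine le_antisymm (sup_le (fun s hs => ?_) (fun t ht => ?_))
    (MeasurableSpace.generateFrom_le ?_)
  · exact MeasurableSpace.measurableSet_generateFrom
      ⟨s, Set.univ, hs, MeasurableSet.univ, Set.inter_univ s⟩
  · exact MeasurableSpace.measurableSet_generateFrom
      ⟨Set.univ, t, MeasurableSet.univ, ht, Set.univ_inter t⟩
  · rintro u ⟨s, t, hs, ht, rfl⟩
    exact MeasurableSet.inter ((le_sup_left : m₁ ≤ m₁ ⊔ m₂) s hs)
      ((le_sup_right : m₂ ≤ m₁ ⊔ m₂) t ht)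

/-- A π-λ argument: the sets `s ∩ t` form a π-system generating the join. The case where both are
`univ` gives total integral zero, which handles complements. -/
theorem setIntegral_eq_zero_of_measurableSet_sup (hm₁ : m₁ ≤ mΩ) (hm₂ : m₂ ≤ mΩ) {f : Ω → ℝ}
    (hf : Integrable f μ)
    (h : ∀ s t, MeasurableSet[m₁] s → MeasurableSet[m₂] t → ∫ ω in s ∩ t, f ω ∂μ = 0)
    {u : Set Ω} (hu : MeasurableSet[m₁ ⊔ m₂] u) : ∫ ω in u, f ω ∂μ = 0 := by
  have hle : m₁ ⊔ m₂ ≤ mΩ := sup_le hm₁ hm₂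
  induction u, hu using MeasurableSpace.induction_on_inter
    MeasurableSpace.sup_eq_generateFrom_inter with
  | h_inter =>
    rintro _ ⟨s, t, hs, ht, rfl⟩ _ ⟨s', t', hs', ht', rfl⟩ -
    exact ⟨s ∩ s', t ∩ t', MeasurableSet.inter hs hs', MeasurableSet.inter ht ht',
      Set.inter_inter_inter_comm s s' t t'⟩
  | empty => simp
  | basic u hu =>
    obtain ⟨s, t, hs, ht, rfl⟩ := hu
    exact h s t hs ht
  | compl t ht ih =>
    have := integral_add_compl (hle t ht) hf
    have huniv := h Set.univ Set.univ MeasurableSet.univ MeasurableSet.univ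
    rw [Set.univ_inter, setIntegral_univ] at huniv
    linarith
  | iUnion g hg hgm ih =>
    rw [integral_iUnion (fun i => hle _ (hgm i)) hg hf.integrableOn]
    simp [ih]

theorem condExp_ae_eq_zero_of_forall_setIntegral_eq_zero [IsFiniteMeasure μ] (hm : m ≤ mΩ)
    {f : Ω → ℝ} (hf : Integrable f μ) (h : ∀ s, MeasurableSet[m] s → ∫ ω in s, f ω ∂μ = 0) :
    μ[f | m] =ᵐ[μ] 0 := by
  refine (ae_eq_condExp_of_forall_setIntegral_eq hm hf (g := 0) (fun s _ _ => ?_)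
    (fun s hs _ => ?_) ?_).symm
  · exact (integrable_zero Ω ℝ μ).integrableOn
  · simp [h s hs]
  · exact stronglyMeasurable_zero.aestronglyMeasurable

/-- Pulling out the `m`-measurable factor expresses the defect of the product formula as a
conditional mean, so conditional independence becomes a statement about integrals of `1_t - P(t |
m)`. -/
theorem condExp_indicator_sub_condExp [IsFiniteMeasure μ] {s t : Set Ω}
    (hs : MeasurableSet[mΩ] s) (ht : MeasurableSet[mΩ] t) :
    μ[s.indicator (t.indicator (fun _ => (1 : ℝ)) - μ⟦t | m⟧) | m] =ᵐ[μ]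
      μ⟦s ∩ t | m⟧ - μ⟦s | m⟧ * μ⟦t | m⟧ := by
  have hi : ∀ {u : Set Ω}, MeasurableSet[mΩ] u → Integrable (u.indicator fun _ => (1 : ℝ)) μ :=
    fun hu => (integrable_const 1).indicator hu
  have heq : s.indicator (t.indicator (fun _ => (1 : ℝ)) - μ⟦t | m⟧) =
      (s ∩ t).indicator (fun _ => (1 : ℝ)) - s.indicator (fun _ => (1 : ℝ)) * μ⟦t | m⟧ := by
    ext ω
    by_cases h1 : ω ∈ s <;> by_cases h2 : ω ∈ t <;> simp [h1, h2]
  have hprod : Integrable (s.indicator (fun _ => (1 : ℝ)) * μ⟦t | m⟧) μ := by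
    have : s.indicator (fun _ => (1 : ℝ)) * μ⟦t | m⟧ = s.indicator (μ⟦t | m⟧) := by
      ext ω
      by_cases h1 : ω ∈ s <;> simp [h1]
    rw [this]
    exact integrable_condExp.indicator hs
  rw [heq]
  refine (condExp_sub (hi (hs.inter ht)) hprod m).trans ?_
  exact Filter.EventuallyEq.sub Filter.EventuallyEq.rfl
    (condExp_mul_of_stronglyMeasurable_right stronglyMeasurable_condExp hprod (hi hs))

theorem integrable_indicator_sub_condExp [IsFiniteMeasure μ] {t : Set Ω}
    (ht : MeasurableSet[mΩ] t) :
    Integrable (t.indicator (fun _ => (1 : ℝ)) - μ⟦t | m⟧) μ :=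
  ((integrable_const 1).indicator ht).sub integrable_condExp

/-- Conditional independence tested on set integrals of `1_t - P(t | m)`. -/
theorem condIndepGiven_iff_setIntegral [IsFiniteMeasure μ] (hm : m ≤ mΩ) (hm₁ : m₁ ≤ mΩ)
    (hm₂ : m₂ ≤ mΩ) :
    CondIndepGiven m m₁ m₂ μ ↔ ∀ t, MeasurableSet[m₂] t → ∀ u, MeasurableSet[m₁ ⊔ m] u →
      ∫ ω in u, (t.indicator (fun _ => (1 : ℝ)) - μ⟦t | m⟧) ω ∂μ = 0 := by
  constructor
  · intro h t ht u hu
    have hψ : Integrable (t.indicator (fun _ => (1 : ℝ)) - μ⟦t | m⟧) μ :=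
      integrable_indicator_sub_condExp (hm₂ t ht)
    refine setIntegral_eq_zero_of_measurableSet_sup hm₁ hm hψ (fun s g hs hg => ?_) hu
    rw [Set.inter_comm, ← setIntegral_indicator (hm₁ s hs),
      ← setIntegral_condExp hm (hψ.indicator (hm₁ s hs)) hg]
    have h0 : μ[s.indicator (t.indicator (fun _ => (1 : ℝ)) - μ⟦t | m⟧) | m] =ᵐ[μ] 0 := by
      filter_upwards [condExp_indicator_sub_condExp (m := m) (μ := μ) (hm₁ s hs) (hm₂ t ht),
        h s t hs ht] with ω h1 h2
      rw [h1, Pi.sub_apply, h2, sub_self, Pi.zero_apply]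
    rw [setIntegral_congr_ae (g := fun _ => (0 : ℝ)) (hm g hg) (h0.mono fun ω hω _ => hω)]
    simp
  · intro h s t hs ht
    have hψ : Integrable (t.indicator (fun _ => (1 : ℝ)) - μ⟦t | m⟧) μ :=
      integrable_indicator_sub_condExp (hm₂ t ht)
    have h0 : μ[s.indicator (t.indicator (fun _ => (1 : ℝ)) - μ⟦t | m⟧) | m] =ᵐ[μ] 0 := by
      refine condExp_ae_eq_zero_of_forall_setIntegral_eq_zero hm
        (hψ.indicator (hm₁ s hs)) fun g hg => ?_
      rw [setIntegral_indicator (hm₁ s hs)]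
      exact h t ht _ (MeasurableSet.inter ((le_sup_right : m ≤ m₁ ⊔ m) g hg)
        ((le_sup_left : m₁ ≤ m₁ ⊔ m) s hs))
    filter_upwards [condExp_indicator_sub_condExp (m := m) (μ := μ) (hm₁ s hs) (hm₂ t ht),
      h0] with ω h1 h2
    rw [h1, Pi.zero_apply, Pi.sub_apply, sub_eq_zero] at h2
    exact h2

/-- If `m₁` is contained in `n ⊔ m` with `n` independent of `m₂ ⊔ m`, then `m₁` and `m₂` are
conditionally independent given `m`. -/
theorem CondIndepGiven.of_indep [IsProbabilityMeasure μ] {n : MeasurableSpace Ω} (hm : m ≤ mΩ)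
    (hm₁ : m₁ ≤ mΩ) (hm₂ : m₂ ≤ mΩ) (hn : n ≤ mΩ) (hle : m₁ ≤ n ⊔ m)
    (hindep : Indep n (m₂ ⊔ m) μ) : CondIndepGiven m m₁ m₂ μ := by
  rw [condIndepGiven_iff_setIntegral hm hm₁ hm₂]
  intro t ht u hu
  have hψ : Integrable (t.indicator (fun _ => (1 : ℝ)) - μ⟦t | m⟧) μ :=
    integrable_indicator_sub_condExp (hm₂ t ht)
  have hψm : StronglyMeasurable[m₂ ⊔ m] (t.indicator (fun _ => (1 : ℝ)) - μ⟦t | m⟧) :=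
    (stronglyMeasurable_const.indicator ((le_sup_left : m₂ ≤ m₂ ⊔ m) t ht)).sub
      (stronglyMeasurable_condExp.mono le_sup_right)
  refine setIntegral_eq_zero_of_measurableSet_sup hn hm hψ (fun s g hs hg => ?_)
    (sup_le hle le_sup_right u hu)
  have hgm : MeasurableSet[m₂ ⊔ m] g := (le_sup_right : m ≤ m₂ ⊔ m) g hg
  have hsup : m₂ ⊔ m ≤ mΩ := sup_le hm₂ hm
  -- The integrand is measurable for `m₂ ⊔ m`, hence independent of `n`; its conditional expectation
  -- given `n` is therefore its mean, which is zero because `g ∈ m`.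
  have hzero : ∫ ω, g.indicator (t.indicator (fun _ => (1 : ℝ)) - μ⟦t | m⟧) ω ∂μ = 0 := by
    rw [integral_indicator (hm g hg)]
    simp only [Pi.sub_apply]
    rw [integral_sub ((integrable_const (1 : ℝ)).indicator (hm₂ t ht)).integrableOn
      integrable_condExp.integrableOn,
      setIntegral_condExp hm ((integrable_const (1 : ℝ)).indicator (hm₂ t ht)) hg, sub_self]
  have hcond := condExp_indep_eq hsup hn (hψm.indicator hgm) hindep.symm
  rw [← setIntegral_indicator (hm g hg),
    ← setIntegral_condExp hn (hψ.indicator (hm g hg)) hs,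
    setIntegral_congr_ae (g := fun _ => (0 : ℝ)) (hn s hs)
      (hcond.mono fun ω hω _ => hω.trans hzero)]
  simp

/-- Under conditional independence, a function of the first block and of the conditioning block
with vanishing conditional mean is orthogonal to every function of the second block. -/
theorem CondIndepGiven.integral_mul_eq_zero [IsProbabilityMeasure μ] (hm : m ≤ mΩ)
    (hm₁ : m₁ ≤ mΩ) (hm₂ : m₂ ≤ mΩ) (h : CondIndepGiven m m₁ m₂ μ) {f g : Ω → ℝ}
    (hf : StronglyMeasurable[m₂] f) (hg : StronglyMeasurable[m₁ ⊔ m] g) (hgi : Integrable g μ)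
    (hfg : Integrable (f * g) μ) (hg0 : μ[g | m] =ᵐ[μ] 0) : ∫ ω, f ω * g ω ∂μ = 0 := by
  rw [condIndepGiven_iff_setIntegral hm hm₁ hm₂] at h
  have hsup : m₁ ⊔ m ≤ mΩ := sup_le hm₁ hm
  -- Split `1_t = (1_t - P(t | m)) + P(t | m)`. The first part has zero conditional mean given `m₁ ⊔
  -- m`, for which `g` is measurable; the second is `m`-measurable, and `g` has zero conditional
  -- mean given `m`.
  have hg2 : μ[g | m₂] =ᵐ[μ] 0 := by
    refine condExp_ae_eq_zero_of_forall_setIntegral_eq_zero hm₂ hgi fun t ht => ?_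
    have hi : Integrable (t.indicator fun _ => (1 : ℝ)) μ :=
      (integrable_const 1).indicator (hm₂ t ht)
    have hψ : Integrable (t.indicator (fun _ => (1 : ℝ)) - μ⟦t | m⟧) μ :=
      integrable_indicator_sub_condExp (hm₂ t ht)
    have hbdd : ∀ᵐ ω ∂μ, |(μ⟦t | m⟧) ω| ≤ 1 := by
      refine ae_bdd_abs_condExp_of_ae_bdd_abs (Filter.Eventually.of_forall fun ω => ?_)
      by_cases hω : ω ∈ t <;> simp [hω]
    have hig : t.indicator (fun _ => (1 : ℝ)) * g = t.indicator g := by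
      ext ω
      by_cases hω : ω ∈ t <;> simp [hω]
    have hint1 : Integrable (t.indicator (fun _ => (1 : ℝ)) * g) μ := by
      rw [hig]
      exact hgi.indicator (hm₂ t ht)
    have hint2 : Integrable (μ⟦t | m⟧ * g) μ :=
      hgi.bdd_mul (c := 1) integrable_condExp.aestronglyMeasurable
        (hbdd.mono fun ω hω => by simpa using hω)
    have hψ0 := condExp_ae_eq_zero_of_forall_setIntegral_eq_zero hsup hψ (h t ht)
    have e1 : ∫ ω, ((t.indicator (fun _ => (1 : ℝ)) - μ⟦t | m⟧) * g) ω ∂μ = 0 := by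
      have hint : Integrable ((t.indicator (fun _ => (1 : ℝ)) - μ⟦t | m⟧) * g) μ := by
        rw [sub_mul]
        exact hint1.sub hint2
      rw [← integral_condExp hsup,
        integral_congr_ae (condExp_mul_of_stronglyMeasurable_right hg hint hψ),
        integral_congr_ae (g := fun _ => (0 : ℝ)) (hψ0.mono fun ω hω => by simp [hω])]
      simp
    have e2 : ∫ ω, (μ⟦t | m⟧ * g) ω ∂μ = 0 := by
      rw [← integral_condExp hm,
        integral_congr_ae (condExp_mul_of_stronglyMeasurable_left stronglyMeasurable_condExp
          hint2 hgi),
        integral_congr_ae (g := fun _ => (0 : ℝ)) (hg0.mono fun ω hω => by simp [hω])]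
      simp
    rw [sub_mul, integral_sub' hint1 hint2, e2, sub_zero, hig,
      integral_indicator (hm₂ t ht)] at e1
    exact e1
  change ∫ ω, (f * g) ω ∂μ = 0
  rw [← integral_condExp hm₂,
    integral_congr_ae (condExp_mul_of_stronglyMeasurable_left hf hfg hgi),
    integral_congr_ae (g := fun _ => (0 : ℝ)) (hg2.mono fun ω hω => by simp [hω])]
  simp

end CondIndep

/-! ### Regression and zero blocks of the precision matrix -/

section LinearAlgebra

variable {ι : Type*} [Fintype ι] {S Q : Matrix ι ι ℝ} {A B C : Set ι}

open Matrix in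
/-- Orthogonal projection onto the coordinate subspace of `C` for a positive definite form. -/
theorem Matrix.PosDef.exists_projection (hS : S.PosDef) (C : Set ι) (h : ι → ℝ) :
    ∃ k : ι → ℝ, (∀ i ∉ C, k i = 0) ∧ ∀ j ∈ C, (S *ᵥ (h - k)) j = 0 := by
  classical
  let S' : Matrix C C ℝ := S.submatrix Subtype.val Subtype.val
  have hS' : S'.PosDef := hS.submatrix Subtype.val_injective
  -- The solution of the normal equations on `C`, extended by zero below.
  let k' : C → ℝ := S'⁻¹ *ᵥ fun c => (S *ᵥ h) c
  refine ⟨fun i => if hi : i ∈ C then k' ⟨i, hi⟩ else 0, fun i hi => dif_neg hi,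
    fun j hj => ?_⟩
  have h1 : (S' *ᵥ k') ⟨j, hj⟩ = (S *ᵥ h) j := by
    rw [Matrix.mulVec_mulVec, Matrix.mul_nonsing_inv _
      ((Matrix.isUnit_iff_isUnit_det S').1 hS'.isUnit), Matrix.one_mulVec]
  have h2 : (S *ᵥ fun i => if hi : i ∈ C then k' ⟨i, hi⟩ else 0) j = (S' *ᵥ k') ⟨j, hj⟩ := by
    simp only [Matrix.mulVec, dotProduct]
    rw [← Finset.sum_filter_add_sum_filter_not Finset.univ (· ∈ C),
      Finset.sum_eq_zero (s := Finset.univ.filter (· ∉ C)) fun i hi => by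
        rw [dif_neg (Finset.mem_filter.1 hi).2, mul_zero],
      add_zero, Finset.sum_subtype (p := (· ∈ C)) _ fun i => by simp]
    refine Finset.sum_congr (by congr) fun c _ => ?_
    rw [dif_pos c.2]
    rfl
  rw [Matrix.mulVec_sub, Pi.sub_apply, h2, h1, sub_self]

open Matrix in
theorem dotProduct_eq_zero_of_disjoint {u v : ι → ℝ} (h : ∀ i, u i = 0 ∨ v i = 0) :
    u ⬝ᵥ v = 0 :=
  Finset.sum_eq_zero fun i _ => by rcases h i with h | h <;> simp [h]

open Matrix in
theorem Matrix.PosDef.eq_zero_of_dotProduct_mulVec (hS : S.PosDef) {v : ι → ℝ}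
    (h : v ⬝ᵥ S *ᵥ v = 0) : v = 0 := by
  by_contra hv
  have := hS.dotProduct_mulVec_pos hv
  simp [h] at this

open Matrix in
/-- If the precision matrix `Q` has no entries between `A` and `B`, the residuals of the block `A`
after regression on `C` are uncorrelated with the block `B`. -/
theorem mulVec_eq_zero_of_precision_eq_zero [DecidableEq ι] (hQ : Q.PosDef) (hQS : Q * S = 1)
    (hcover : ∀ i, i ∈ A ∨ i ∈ B ∨ i ∈ C) (hCB : ∀ i ∈ C, i ∉ B)
    (hzero : ∀ i ∈ A, ∀ j ∈ B, Q i j = 0) {r : ι → ℝ} (hr : ∀ j ∈ B, r j = 0)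
    (hC : ∀ j ∈ C, (S *ᵥ r) j = 0) : ∀ j ∈ B, (S *ᵥ r) j = 0 := by
  classical
  have hsymm : ∀ i j, Q i j = Q j i := fun i j => by simpa using hQ.isHermitian.apply j i
  set s := S *ᵥ r with hs
  have hQs : Q *ᵥ s = r := by rw [hs, Matrix.mulVec_mulVec, hQS, Matrix.one_mulVec]
  -- With t = s restricted to `B`, the rest `s - t` lives on `A`, since `s` vanishes on `C`; so
  -- tᵀQ(s - t) = 0. Also tᵀQs = tᵀr = 0, as `r` vanishes on `B`. Hence tᵀQt = 0 and definiteness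
  -- gives t = 0.
  let t : ι → ℝ := fun i => if i ∈ B then s i else 0
  have h1 : t ⬝ᵥ Q *ᵥ s = 0 := by
    rw [hQs]
    refine dotProduct_eq_zero_of_disjoint fun i => ?_
    by_cases hi : i ∈ B
    · exact Or.inr (hr i hi)
    · exact Or.inl (if_neg hi)
  have h2 : t ⬝ᵥ Q *ᵥ (s - t) = 0 := by
    refine dotProduct_eq_zero_of_disjoint fun i => ?_
    by_cases hi : i ∈ B
    · refine Or.inr (dotProduct_eq_zero_of_disjoint fun j => ?_)
      rcases hcover j with hj | hj | hj
      · left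
        rw [hsymm]
        exact hzero j hj i hi
      · right
        simp [t, hj]
      · right
        simp [t, hCB j hj, hC j hj]
    · exact Or.inl (if_neg hi)
  have h3 : t ⬝ᵥ Q *ᵥ t = 0 := by
    rw [Matrix.mulVec_sub, dotProduct_sub, h1] at h2
    linarith
  have h4 := hQ.eq_zero_of_dotProduct_mulVec h3
  intro j hj
  have := congrFun h4 j
  simpa [t, hj] using this

open Matrix in
/-- If every combination of the blocks `A`, `C` which is orthogonal to `C` is orthogonal to `B`,
then the precision matrix `Q` has no entries between `A` and `B`. -/
theorem precision_eq_zero_of_orthogonal [DecidableEq ι] (hS : S.PosDef) (hQS : Q * S = 1)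
    (hcover : ∀ i, i ∈ A ∨ i ∈ B ∨ i ∈ C) (hAB : ∀ i ∈ A, i ∉ B) (hCB : ∀ i ∈ C, i ∉ B)
    (hAC : ∀ i ∈ A, i ∉ C)
    (horth : ∀ g : ι → ℝ, (∀ j ∈ B, g j = 0) → (∀ j ∈ C, (S *ᵥ g) j = 0) →
      ∀ j ∈ B, (S *ᵥ g) j = 0) : ∀ j ∈ B, ∀ i ∈ A, Q j i = 0 := by
  classical
  intro j hj
  -- Row `j` of `Q` restricted to `A`; subtracting its projection `k` onto `C` gives g = h - k.
  -- Since Q_j and h differ only on `B ∪ C`, where S g vanishes, gᵀSg equals Q_jᵀSg = g_j = 0. So g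
  -- = 0, and on `A` this says that row `j` is zero.
  let h : ι → ℝ := fun i => if i ∈ A then Q j i else 0
  obtain ⟨k, hk, hkC⟩ := hS.exists_projection C h
  have hgB : ∀ i ∈ B, (h - k) i = 0 := fun i hi => by
    have h1 : i ∉ A := fun hA => hAB i hA hi
    have h2 : i ∉ C := fun hC => hCB i hC hi
    simp [h, h1, hk i h2]
  have hsB := horth (h - k) hgB hkC
  have h1 : Q j ⬝ᵥ S *ᵥ (h - k) = 0 := by
    have : (Q *ᵥ (S *ᵥ (h - k))) j = 0 := by
      rw [Matrix.mulVec_mulVec, hQS, Matrix.one_mulVec]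
      exact hgB j hj
    exact this
  have h2 : (Q j - h) ⬝ᵥ S *ᵥ (h - k) = 0 := by
    refine dotProduct_eq_zero_of_disjoint fun i => ?_
    rcases hcover i with hi | hi | hi
    · left
      simp [h, hi]
    · exact Or.inr (hsB i hi)
    · exact Or.inr (hkC i hi)
  have h3 : k ⬝ᵥ S *ᵥ (h - k) = 0 := by
    refine dotProduct_eq_zero_of_disjoint fun i => ?_
    by_cases hi : i ∈ C
    · exact Or.inr (hkC i hi)
    · exact Or.inl (hk i hi)
  have h4 : (h - k) ⬝ᵥ S *ᵥ (h - k) = 0 := by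
    rw [sub_dotProduct] at h2 ⊢
    linarith
  have h5 := hS.eq_zero_of_dotProduct_mulVec h4
  intro i hi
  have := congrFun h5 i
  simpa [h, hi, hk i (hAC i hi)] using this

end LinearAlgebra

/-! ### Conditional independence for Gaussian coordinates -/

section Gaussian

variable {Ω ι : Type*}

/-- The σ-algebra generated by the real random variables `X i`, `i ∈ A`. -/
abbrev coordAlg (X : ι → Ω → ℝ) (A : Set ι) : MeasurableSpace Ω :=
  ⨆ i ∈ A, MeasurableSpace.comap (X i) inferInstance

theorem comap_pi_eq_iSup {α : Type*} {E : α → Type*} [∀ a, MeasurableSpace (E a)]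
    (f : ∀ a, Ω → E a) :
    MeasurableSpace.comap (fun ω a => f a ω) MeasurableSpace.pi =
      ⨆ a, MeasurableSpace.comap (f a) inferInstance := by
  simp only [MeasurableSpace.pi, MeasurableSpace.comap_iSup, MeasurableSpace.comap_comp]
  rfl

theorem coordAlg_le [mΩ : MeasurableSpace Ω] {X : ι → Ω → ℝ} (hX : ∀ i, Measurable (X i)) (A : Set ι) :
    coordAlg X A ≤ mΩ :=
  iSup₂_le fun i _ => (hX i).comap_le

theorem measurable_coordAlg (X : ι → Ω → ℝ) {A : Set ι} {i : ι} (hi : i ∈ A) :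
    Measurable[coordAlg X A] (X i) :=
  measurable_iff_comap_le.2
    (le_iSup₂_of_le (f := fun i _ => MeasurableSpace.comap (X i) inferInstance) i hi le_rfl)

variable [Fintype ι]

/-- The linear combination of the random variables `X i` with coefficients `v`. -/
def linComb (X : ι → Ω → ℝ) (v : ι → ℝ) (ω : Ω) : ℝ := ∑ i, v i * X i ω

theorem linComb_measurable {X : ι → Ω → ℝ} {m : MeasurableSpace Ω} {v : ι → ℝ}
    (h : ∀ i, v i ≠ 0 → Measurable[m] (X i)) : Measurable[m] (linComb X v) := by
  refine Finset.measurable_fun_sum _ fun i _ => ?_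
  by_cases hv : v i = 0
  · simp only [hv, zero_mul]
    exact measurable_const
  · exact (h i hv).const_mul (v i)

theorem linComb_single [DecidableEq ι] (X : ι → Ω → ℝ) (i : ι) :
    linComb X (Pi.single i 1) = X i := by
  ext ω
  simp [linComb, Pi.single_apply]

theorem linComb_add (X : ι → Ω → ℝ) (u v : ι → ℝ) :
    linComb X (u + v) = fun ω => linComb X u ω + linComb X v ω := by
  ext ω
  simp [linComb, add_mul, Finset.sum_add_distrib]

variable [mΩ : MeasurableSpace Ω] {μ : Measure Ω}

theorem memLp_linComb {X : ι → Ω → ℝ} (hX : ∀ i, MemLp (X i) 2 μ) (v : ι → ℝ) :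
    MemLp (linComb X v) 2 μ :=
  memLp_finsetSum _ fun i _ => (hX i).const_mul (v i)

/-- The covariance matrix of a finite family of real random variables. -/
noncomputable def covMat (μ : Measure Ω) (X : ι → Ω → ℝ) : Matrix ι ι ℝ :=
  Matrix.of fun i j => cov[X i, X j; μ]

open Matrix in
theorem covariance_linComb [IsFiniteMeasure μ] {X : ι → Ω → ℝ} (hX : ∀ i, MemLp (X i) 2 μ)
    (u v : ι → ℝ) : cov[linComb X u, linComb X v; μ] = u ⬝ᵥ covMat μ X *ᵥ v := by
  unfold linComb
  rw [covariance_fun_sum_fun_sum (fun i => (hX i).const_mul (u i))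
    (fun j => (hX j).const_mul (v j))]
  simp only [covariance_const_mul_left, covariance_const_mul_right, dotProduct, Matrix.mulVec,
    covMat, Matrix.of_apply, Finset.mul_sum]
  refine Finset.sum_congr rfl fun i _ => Finset.sum_congr rfl fun j _ => ?_
  ring

theorem covMat_posSemidef [IsFiniteMeasure μ] {X : ι → Ω → ℝ} (hX : ∀ i, MemLp (X i) 2 μ) :
    (covMat μ X).PosSemidef := by
  refine Matrix.PosSemidef.of_dotProduct_mulVec_nonneg ?_ fun v => ?_
  · ext i j
    simp [covMat, covariance_comm]
  · rw [star_trivial, ← covariance_linComb hX,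
      covariance_self (memLp_linComb hX v).aestronglyMeasurable.aemeasurable]
    exact variance_nonneg _ _

open Matrix in
/-- Uncorrelated families of linear combinations of a Gaussian vector are independent. -/
theorem indep_linComb {α β : Type*} [Finite α] [Finite β] {X : ι → Ω → ℝ}
    (hX : HasGaussianLaw (fun ω i => X i ω) μ) (u : α → ι → ℝ) (v : β → ι → ℝ)
    (h : ∀ a b, u a ⬝ᵥ covMat μ X *ᵥ v b = 0) :
    Indep (⨆ a, MeasurableSpace.comap (linComb X (u a)) inferInstance)
      (⨆ b, MeasurableSpace.comap (linComb X (v b)) inferInstance) μ := by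
  have := Fintype.ofFinite α
  have := Fintype.ofFinite β
  have := hX.isProbabilityMeasure
  have hL : ∀ i, MemLp (X i) 2 μ := fun i => (hX.eval i).memLp_two
  -- Both families together are one linear image of `X`, hence jointly Gaussian, so zero
  -- cross-covariance gives independence.
  have hG : HasGaussianLaw
      (fun ω => ((fun a => linComb X (u a) ω), (fun b => linComb X (v b) ω))) μ := by
    have := hX.map_fun ((LinearMap.toContinuousLinearMap
      ((Matrix.mulVecLin (Matrix.of u)).prod (Matrix.mulVecLin (Matrix.of v)))))
    exact this
  have hI := hG.indepFun_of_covariance_eval fun a b => by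
    rw [covariance_linComb hL, h]
  rw [IndepFun_iff_Indep] at hI
  rw [← comap_pi_eq_iSup, ← comap_pi_eq_iSup]
  exact hI

open Matrix in
/-- For a nonsingular Gaussian vector whose index set is partitioned into `A`, `B`, `C`, the
blocks `A` and `B` are conditionally independent given `C` if and only if the corresponding block
of the precision matrix vanishes. -/
theorem condIndepGiven_coordAlg_iff [DecidableEq ι] {X : ι → Ω → ℝ}
    (hXm : ∀ i, Measurable (X i))
    (hX : HasGaussianLaw (fun ω i => X i ω) μ) (hX0 : ∀ i, ∫ ω, X i ω ∂μ = 0)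
    {Q : Matrix ι ι ℝ} (hQ : Q * covMat μ X = 1) {A B C : Set ι}
    (hcover : ∀ i, i ∈ A ∨ i ∈ B ∨ i ∈ C) (hAB : ∀ i ∈ A, i ∉ B) (hCB : ∀ i ∈ C, i ∉ B)
    (hAC : ∀ i ∈ A, i ∉ C) :
    CondIndepGiven (coordAlg X C) (coordAlg X A) (coordAlg X B) μ ↔
      ∀ i ∈ A, ∀ j ∈ B, Q i j = 0 := by
  have := hX.isProbabilityMeasure
  have hL : ∀ i, MemLp (X i) 2 μ := fun i => (hX.eval i).memLp_two
  have hS : (covMat μ X).PosDef := by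
    rw [(covMat_posSemidef hL).posDef_iff_isUnit]
    exact (Matrix.isUnit_iff_isUnit_det _).2 (Matrix.isUnit_det_of_left_inverse hQ)
  have hQinv : Q = (covMat μ X)⁻¹ := (Matrix.inv_eq_left_inv hQ).symm
  have hQpd : Q.PosDef := hQinv ▸ hS.inv
  have hsymm : ∀ i j, Q i j = Q j i := fun i j => by simpa using hQpd.isHermitian.apply j i
  have hcoord : ∀ D : Set ι, coordAlg X D =
      ⨆ i : D, MeasurableSpace.comap (linComb X (Pi.single (i : ι) 1)) inferInstance := by
    intro D
    simp only [linComb_single]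
    rw [iSup_subtype]
  have hlm : ∀ v, Measurable (linComb X v) := fun v => linComb_measurable fun i _ => hXm i
  have hL2 : ∀ v, MemLp (linComb X v) 2 μ := memLp_linComb hL
  have hmean : ∀ v, ∫ ω, linComb X v ω ∂μ = 0 := fun v => by
    unfold linComb
    rw [integral_finsetSum _ fun i _ => ((hL i).integrable (by norm_num)).const_mul (v i)]
    simp [integral_const_mul, hX0]
  constructor
  · intro h i hi j hj
    rw [hsymm]
    refine precision_eq_zero_of_orthogonal hS hQ hcover hAB hCB hAC (fun g hgB hgC b hb => ?_)
      j hj i hi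
    have hgm : Measurable[coordAlg X A ⊔ coordAlg X C] (linComb X g) := by
      refine linComb_measurable fun i hgi => ?_
      rcases hcover i with h' | h' | h'
      · exact (measurable_coordAlg X h').mono le_sup_left le_rfl
      · exact absurd (hgB i h') hgi
      · exact (measurable_coordAlg X h').mono le_sup_right le_rfl
    -- Orthogonality to `C` upgrades to independence, so the conditional mean given `C` is the plain
    -- mean, namely zero.
    have hind : Indep (MeasurableSpace.comap (linComb X g) inferInstance) (coordAlg X C) μ := by
      have := indep_linComb hX (fun i : C => Pi.single (i : ι) 1) (fun _ : Unit => g)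
        fun c _ => by
          rw [single_one_dotProduct]
          exact hgC c c.2
      rw [← hcoord, iSup_const] at this
      exact this.symm
    have hg0 : μ[linComb X g | coordAlg X C] =ᵐ[μ] 0 := by
      refine (condExp_indep_eq (hlm g).comap_le (coordAlg_le hXm C)
        (comap_measurable _).stronglyMeasurable hind).trans ?_
      rw [hmean g]
      rfl
    have hint : Integrable (X b * linComb X g) μ := (hL b).integrable_mul (hL2 g)
    have key := h.integral_mul_eq_zero (coordAlg_le hXm C) (coordAlg_le hXm A)
      (coordAlg_le hXm B) (measurable_coordAlg X hb).stronglyMeasurable hgm.stronglyMeasurable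
      ((hL2 g).integrable (by norm_num)) hint hg0
    have hcov := covariance_linComb hL (Pi.single b 1) g
    rw [linComb_single, covariance_eq_sub (hL b) (hL2 g), hX0, zero_mul, sub_zero,
      single_one_dotProduct] at hcov
    rw [← hcov]
    exact key
  · intro h
    -- Each `X i`, `i ∈ A`, is its regression on `C` plus a residual. The residuals are uncorrelated
    -- with `C` by construction and with `B` by the vanishing precision block, hence independent of
    -- both blocks jointly.
    choose k hk hkC using fun i : A => hS.exists_projection C (Pi.single (i : ι) 1)
    have hrB : ∀ i : A, ∀ j ∈ B, (covMat μ X *ᵥ (Pi.single (i : ι) 1 - k i)) j = 0 := fun i =>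
      mulVec_eq_zero_of_precision_eq_zero hQpd hQ hcover hCB h
        (fun j hj => by
          have h1 : j ≠ i := fun hji => hAB i i.2 (hji ▸ hj)
          have h2 : j ∉ C := fun hC => hCB j hC hj
          simp [hk i j h2, Pi.single_eq_of_ne h1]) (hkC i)
    refine CondIndepGiven.of_indep
      (n := ⨆ i : A, MeasurableSpace.comap (linComb X (Pi.single (i : ι) 1 - k i)) inferInstance)
      (coordAlg_le hXm C) (coordAlg_le hXm A) (coordAlg_le hXm B)
      (iSup_le fun i => (hlm _).comap_le) (iSup₂_le fun i hi => ?_) ?_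
    · rw [← measurable_iff_comap_le]
      have heq : X i = fun ω => linComb X (Pi.single i 1 - k ⟨i, hi⟩) ω +
          linComb X (k ⟨i, hi⟩) ω := by
        rw [← linComb_add, sub_add_cancel, linComb_single]
      rw [heq]
      have hle := le_iSup (fun i : A => MeasurableSpace.comap
        (linComb X (Pi.single (i : ι) 1 - k i)) (inferInstance : MeasurableSpace ℝ)) ⟨i, hi⟩
      refine Measurable.add (measurable_iff_comap_le.2 (le_sup_of_le_left hle)) ?_
      refine linComb_measurable fun j hj => ?_
      have hjC : j ∈ C := by
        by_contra hjC
        exact hj (hk _ j hjC)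
      exact (measurable_coordAlg X hjC).mono le_sup_right le_rfl
    · have hBC : coordAlg X B ⊔ coordAlg X C = coordAlg X (B ∪ C) := by
        simp only [coordAlg]
        rw [iSup_union]
      rw [hBC, hcoord (B ∪ C)]
      have horth : ∀ (i : ↑(B ∪ C)) (a : A), (Pi.single (i : ι) (1 : ℝ) : ι → ℝ) ⬝ᵥ
          covMat μ X *ᵥ (Pi.single (a : ι) 1 - k a) = 0 := fun i a => by
        rw [single_one_dotProduct]
        exact i.2.elim (hrB a i) (hkC a i)
      have hind := indep_linComb hX _ _ horth
      exact hind.symm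

end Gaussian

/-! ### Markov and reciprocal sequences in terms of precision blocks -/

section Sequence

variable {Ω : Type*} [mΩ : MeasurableSpace Ω] {μ : Measure Ω} {d N : ℕ}

/-- The scalar coordinates of the vectors `x k`, `k ∈ T`. -/
abbrev seqCoord (T : Finset ℕ) (x : ℕ → Ω → Fin d → ℝ) (p : T × Fin d) (ω : Ω) : ℝ :=
  x p.1 ω p.2

omit mΩ in
theorem sigmaGen_eq_coordAlg {T : Finset ℕ} (x : ℕ → Ω → Fin d → ℝ) {A : Set ℕ}
    (hA : ∀ k ∈ A, k ∈ T) :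
    sigmaGen x A = coordAlg (seqCoord T x) {p | (p.1 : ℕ) ∈ A} := by
  have hk : ∀ k, MeasurableSpace.comap (x k) inferInstance =
      ⨆ i, MeasurableSpace.comap (fun ω => x k ω i) inferInstance :=
    fun k => comap_pi_eq_iSup fun i ω => x k ω i
  refine le_antisymm (iSup₂_le fun k hkA => ?_) (iSup₂_le fun p hp => ?_)
  · rw [hk]
    exact iSup_le fun i => le_iSup₂_of_le
      (f := fun p _ => MeasurableSpace.comap (seqCoord T x p) inferInstance)
      (⟨k, hA k hkA⟩, i) hkA le_rfl
  · refine le_iSup₂_of_le (f := fun k _ => MeasurableSpace.comap (x k) inferInstance)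
      (p.1 : ℕ) hp ?_
    rw [hk]
    exact le_iSup (fun i => MeasurableSpace.comap (fun ω => x p.1 ω i) inferInstance) p.2

/-- The matrix with square blocks `b k l`, `k, l ∈ T`. -/
def blockMat (T : Finset ℕ) (b : ℕ → ℕ → Matrix (Fin d) (Fin d) ℝ) :
    Matrix (T × Fin d) (T × Fin d) ℝ :=
  Matrix.of fun p q => b p.1 q.1 p.2 q.2

/-- Block form of the precision criterion for conditional independence. -/
theorem condIndepGiven_sigmaGen_iff {T : Finset ℕ} {x : ℕ → Ω → Fin d → ℝ}
    (hxm : ∀ k ∈ T, Measurable (x k)) (hG : HasGaussianLaw (fun ω p => seqCoord T x p ω) μ)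
    (h0 : ∀ p, ∫ ω, seqCoord T x p ω ∂μ = 0) {b : ℕ → ℕ → Matrix (Fin d) (Fin d) ℝ}
    (hb : blockMat T b * seqCov μ T x = 1) {A B C : Set ℕ} (hA : ∀ k ∈ A, k ∈ T)
    (hB : ∀ k ∈ B, k ∈ T) (hC : ∀ k ∈ C, k ∈ T) (hcover : ∀ k ∈ T, k ∈ A ∨ k ∈ B ∨ k ∈ C)
    (hAB : ∀ k ∈ A, k ∉ B) (hCB : ∀ k ∈ C, k ∉ B) (hAC : ∀ k ∈ A, k ∉ C) :
    CondIndepGiven (sigmaGen x C) (sigmaGen x A) (sigmaGen x B) μ ↔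
      ∀ k ∈ A, ∀ l ∈ B, b k l = 0 := by
  have hm : ∀ p, Measurable (seqCoord T x p) := fun p =>
    (measurable_pi_apply p.2).comp (hxm p.1 p.1.2)
  rw [sigmaGen_eq_coordAlg x hA, sigmaGen_eq_coordAlg x hB, sigmaGen_eq_coordAlg x hC,
    condIndepGiven_coordAlg_iff (A := {p | (p.1 : ℕ) ∈ A}) (B := {p | (p.1 : ℕ) ∈ B})
      (C := {p | (p.1 : ℕ) ∈ C}) hm hG h0 hb (fun p => hcover p.1 p.1.2) (fun p => hAB p.1) (fun p => hCB p.1) fun p => hAC p.1]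
  constructor
  · intro h k hk l hl
    ext i j
    exact h (⟨k, hA k hk⟩, i) hk (⟨l, hB l hl⟩, j) hl
  · intro h p hp q hq
    exact congrFun (congrFun (h p.1 hp q.1 hq) p.2) q.2

theorem seqCov_transpose (T : Finset ℕ) (x : ℕ → Ω → Fin d → ℝ) :
    (seqCov μ T x).transpose = seqCov μ T x := by
  ext p q
  exact covariance_comm _ _

theorem block_transpose_of_mul_seqCov_eq_one {T : Finset ℕ} {x : ℕ → Ω → Fin d → ℝ}
    {b : ℕ → ℕ → Matrix (Fin d) (Fin d) ℝ} (hb : blockMat T b * seqCov μ T x = 1) {k l : ℕ}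
    (hk : k ∈ T) (hl : l ∈ T) : b l k = (b k l).transpose := by
  have h : (blockMat T b).transpose = blockMat T b := by
    rw [← Matrix.inv_eq_left_inv hb, Matrix.transpose_nonsing_inv, seqCov_transpose]
  ext i j
  exact (congrFun (congrFun h (⟨l, hl⟩, i)) (⟨k, hk⟩, j)).symm

/-- A nonsingular Gaussian sequence is Markov iff its precision matrix is block tridiagonal. -/
theorem isMarkovSeq_iff_precision {x : ℕ → Ω → Fin d → ℝ}
    (hxm : ∀ k ∈ Finset.Icc 0 N, Measurable (x k))
    (hG : HasGaussianLaw (fun ω p => seqCoord (Finset.Icc 0 N) x p ω) μ)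
    (h0 : ∀ p, ∫ ω, seqCoord (Finset.Icc 0 N) x p ω ∂μ = 0)
    {b : ℕ → ℕ → Matrix (Fin d) (Fin d) ℝ}
    (hb : blockMat (Finset.Icc 0 N) b * seqCov μ (Finset.Icc 0 N) x = 1) :
    IsMarkovSeq μ (Finset.Icc 0 N) x ↔ ∀ k l, k + 1 < l → l ≤ N → b k l = 0 := by
  have key : ∀ j ∈ Finset.Icc 0 N, CondIndepGiven (sigmaGen x {j})
      (sigmaGen x {i | i ∈ Finset.Icc 0 N ∧ i < j})
      (sigmaGen x {i | i ∈ Finset.Icc 0 N ∧ j < i}) μ ↔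
      ∀ k ∈ {i | i ∈ Finset.Icc 0 N ∧ i < j}, ∀ l ∈ {i | i ∈ Finset.Icc 0 N ∧ j < i},
        b k l = 0 := by
    intro j hj
    refine condIndepGiven_sigmaGen_iff hxm hG h0 hb (fun k hk => hk.1) (fun k hk => hk.1)
      (fun k hk => ?_) ?_ ?_ ?_ ?_
    · rw [Set.mem_singleton_iff.1 hk]
      exact hj
    all_goals
      intro k hk
      simp only [Set.mem_ofPred_eq, Set.mem_singleton_iff] at *
      grind
  constructor
  · intro h k l hkl hl
    -- Conditioning at `k + 1` separates `k` from `l`.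
    refine (key (k + 1) (by simp; omega)).1 (h _ (by simp; omega)) k ⟨by simp; omega, by omega⟩ l
      ⟨by simpa using hl, hkl⟩
  · intro h j hj
    refine (key j hj).2 fun k hk l hl => h k l ?_ ?_
    · have := hk.2
      have := hl.2
      omega
    · simpa using hl.1

/-- A nonsingular Gaussian sequence is reciprocal iff its precision matrix is cyclically block
tridiagonal. -/
theorem isReciprocalSeq_iff_precision {x : ℕ → Ω → Fin d → ℝ}
    (hxm : ∀ k ∈ Finset.Icc 0 N, Measurable (x k))
    (hG : HasGaussianLaw (fun ω p => seqCoord (Finset.Icc 0 N) x p ω) μ)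
    (h0 : ∀ p, ∫ ω, seqCoord (Finset.Icc 0 N) x p ω ∂μ = 0)
    {b : ℕ → ℕ → Matrix (Fin d) (Fin d) ℝ}
    (hb : blockMat (Finset.Icc 0 N) b * seqCov μ (Finset.Icc 0 N) x = 1) :
    IsReciprocalSeq μ (Finset.Icc 0 N) x ↔
      ∀ k l, k + 1 < l → l ≤ N → ¬(k = 0 ∧ l = N) → b k l = 0 := by
  have hsymm : ∀ k l, k ≤ N → l ≤ N → b k l = 0 → b l k = 0 := fun k l hk hl h => by
    rw [block_transpose_of_mul_seqCov_eq_one hb (by simpa using hk) (by simpa using hl), h,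
      Matrix.transpose_zero]
  have key : ∀ j ∈ Finset.Icc 0 N, ∀ l ∈ Finset.Icc 0 N, j < l →
      (CondIndepGiven (sigmaGen x {j, l})
        (sigmaGen x {i | i ∈ Finset.Icc 0 N ∧ j < i ∧ i < l})
        (sigmaGen x {i | i ∈ Finset.Icc 0 N ∧ (i < j ∨ l < i)}) μ ↔
      ∀ k ∈ {i | i ∈ Finset.Icc 0 N ∧ j < i ∧ i < l},
        ∀ k' ∈ {i | i ∈ Finset.Icc 0 N ∧ (i < j ∨ l < i)}, b k k' = 0) := by
    intro j hj l hl hjl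
    refine condIndepGiven_sigmaGen_iff hxm hG h0 hb (fun k hk => hk.1) (fun k hk => hk.1)
      (fun k hk => ?_) ?_ ?_ ?_ ?_
    · rcases hk with rfl | hk
      · exact hj
      · rw [Set.mem_singleton_iff.1 hk]
        exact hl
    all_goals
      intro k hk
      simp only [Set.mem_ofPred_eq, Set.mem_insert_iff, Set.mem_singleton_iff] at *
      grind
  constructor
  · intro h k l hkl hl hne
    by_cases hk : k = 0
    -- A window of radius one isolates its centre from all times outside it. For `k = 0` no window
    -- around `k` fits, so it is centred at `l`, which is less than `N` because the corner is
    -- excluded.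
    · refine hsymm l k hl (by omega) ((key (l - 1) ?_ (l + 1) ?_ ?_).1
        (h (l - 1) ?_ (l + 1) ?_ ?_) l ⟨?_, ?_⟩ k ⟨?_, ?_⟩)
      all_goals first | omega | (rw [Finset.mem_Icc]; omega)
    · refine (key (k - 1) ?_ (k + 1) ?_ ?_).1
        (h (k - 1) ?_ (k + 1) ?_ ?_) k ⟨?_, ?_⟩ l ⟨?_, ?_⟩
      all_goals first | omega | (rw [Finset.mem_Icc]; omega)
  · intro h j hj l hl hjl
    refine (key j hj l hl hjl).2 fun k hk k' hk' => ?_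
    have h1 := hk.2
    have h2 := Finset.mem_Icc.1 hk.1
    have h3 := Finset.mem_Icc.1 hk'.1
    have h4 := Finset.mem_Icc.1 hl
    -- An end of the window lies strictly between `k` and `k'`, so they differ by at least 2; and
    -- `k`, being interior to the window, is neither 0 nor `N`.
    rcases hk'.2 with h' | h'
    · exact hsymm k' k h3.2 h2.2 (h k' k (by omega) h2.2 (by omega))
    · exact h k k' (by omega) h3.2 (by omega)

end Sequence

/-! ### Precision matrix from a whitening transformation -/

section Whitening

variable {Ω : Type*} [mΩ : MeasurableSpace Ω] {μ : Measure Ω} {d N : ℕ}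

theorem blockMat_mul (T : Finset ℕ) (b b' : ℕ → ℕ → Matrix (Fin d) (Fin d) ℝ) :
    blockMat T b * blockMat T b' = blockMat T fun k l => ∑ m ∈ T, b k m * b' m l := by
  ext p q
  simp only [blockMat, Matrix.mul_apply, Matrix.of_apply, Fintype.sum_prod_type,
    Matrix.sum_apply]
  exact Finset.sum_coe_sort T fun m => ∑ j, b p.1 m p.2 j * b' m q.1 j q.2

theorem blockMat_transpose (T : Finset ℕ) (b : ℕ → ℕ → Matrix (Fin d) (Fin d) ℝ) :
    (blockMat T b).transpose = blockMat T fun k l => (b l k).transpose := rfl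

theorem blockMat_one (T : Finset ℕ) :
    blockMat T (fun k l => if k = l then (1 : Matrix (Fin d) (Fin d) ℝ) else 0) = 1 := by
  ext ⟨k, i⟩ ⟨l, j⟩
  by_cases hkl : k = l
  · subst hkl
    simp [blockMat, Matrix.one_apply]
  · simp [blockMat, hkl]

omit mΩ in
theorem linComb_blockMat (T : Finset ℕ) (b : ℕ → ℕ → Matrix (Fin d) (Fin d) ℝ)
    (x : ℕ → Ω → Fin d → ℝ) (p : T × Fin d) (ω : Ω) :
    linComb (seqCoord T x) (blockMat T b p) ω = (∑ l ∈ T, (b p.1 l).mulVec (x l ω)) p.2 := by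
  simp only [linComb, blockMat, Matrix.of_apply, Fintype.sum_prod_type, Finset.sum_apply,
    Matrix.mulVec, dotProduct]
  exact Finset.sum_coe_sort T fun l => ∑ j, b p.1 l p.2 j * x l ω j

theorem covariance_congr_ae {X X' Y Y' : Ω → ℝ} (hX : X =ᵐ[μ] X') (hY : Y =ᵐ[μ] Y') :
    cov[X, Y; μ] = cov[X', Y'; μ] := by
  unfold covariance
  rw [integral_congr_ae hX, integral_congr_ae hY]
  exact integral_congr_ae (by filter_upwards [hX, hY] with ω h1 h2; rw [h1, h2])

/-- Whiteness makes the full covariance block diagonal, so a null vector of one diagonal block,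
extended by zero, would be a null vector of the whole matrix. -/
theorem det_crossCov_ne_zero {T : Finset ℕ} {e : ℕ → Ω → Fin d → ℝ}
    (hdet : (seqCov μ T e).det ≠ 0) (hwhite : ∀ i ∈ T, ∀ j ∈ T, i ≠ j → crossCov μ (e i) (e j) = 0)
    {k : ℕ} (hk : k ∈ T) : (crossCov μ (e k) (e k)).det ≠ 0 := by
  intro h
  obtain ⟨v, hv, hv0⟩ := Matrix.exists_mulVec_eq_zero_iff.2 h
  refine hdet (Matrix.exists_mulVec_eq_zero_iff.1
    ⟨fun p => if (p.1 : ℕ) = k then v p.2 else 0, fun h0 => hv ?_, ?_⟩)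
  · ext i
    simpa using congrFun h0 (⟨k, hk⟩, i)
  · ext p
    simp only [Matrix.mulVec, dotProduct, Fintype.sum_prod_type, Pi.zero_apply]
    refine Finset.sum_eq_zero fun l _ => ?_
    by_cases hl : (l : ℕ) = k
    · simp only [hl, if_true]
      by_cases hp : (p.1 : ℕ) = k
      · have := congrFun hv0 p.2
        simp only [Matrix.mulVec, dotProduct, Pi.zero_apply] at this
        rw [← this]
        refine Finset.sum_congr rfl fun j _ => ?_
        simp only [seqCov, crossCov, Matrix.of_apply, hl, hp]
      · refine Finset.sum_eq_zero fun j _ => ?_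
        have : crossCov μ (e p.1) (e l) p.2 j = 0 := by
          rw [hwhite p.1 p.1.2 l l.2 (by omega)]
          rfl
        exact mul_eq_zero_of_left this _
    · simp [hl]

/-- If a linear transformation with blocks `b` turns `x` into a white sequence `w` with
covariances `Δ`, the precision matrix of `x` has blocks `∑ m, (b m k)ᵀ (Δ m)⁻¹ (b m l)`. -/
theorem precision_of_whitening [IsFiniteMeasure μ] {T : Finset ℕ} {x w : ℕ → Ω → Fin d → ℝ}
    {b : ℕ → ℕ → Matrix (Fin d) (Fin d) ℝ} {Δ : ℕ → Matrix (Fin d) (Fin d) ℝ}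
    (hx : ∀ p, MemLp (seqCoord T x p) 2 μ)
    (hw : ∀ m ∈ T, ∀ᵐ ω ∂μ, w m ω = ∑ l ∈ T, (b m l).mulVec (x l ω))
    (hcov : ∀ i ∈ T, ∀ j ∈ T, crossCov μ (w i) (w j) = if i = j then Δ i else 0)
    (hdet : ∀ i ∈ T, (Δ i).det ≠ 0) :
    blockMat T (fun k l => ∑ m ∈ T, (b m k).transpose * (Δ m)⁻¹ * b m l) * seqCov μ T x = 1 := by
  have h1 : blockMat T b * seqCov μ T x * (blockMat T b).transpose =
      blockMat T fun i j => if i = j then Δ i else 0 := by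
    ext p q
    rw [Matrix.mul_assoc]
    have e1 : (blockMat T b * (seqCov μ T x * (blockMat T b).transpose)) p q =
        cov[linComb (seqCoord T x) (blockMat T b p), linComb (seqCoord T x) (blockMat T b q); μ] :=
      (covariance_linComb hx _ _).symm
    have e2 : ∀ p : T × Fin d,
        linComb (seqCoord T x) (blockMat T b p) =ᵐ[μ] fun ω => w p.1 ω p.2 := fun p => by
      filter_upwards [hw p.1 p.1.2] with ω hω
      rw [linComb_blockMat, hω]
    rw [e1, covariance_congr_ae (e2 p) (e2 q)]
    exact congrFun (congrFun (hcov p.1 p.1.2 q.1 q.1.2) p.2) q.2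
  have h2 : blockMat T (fun i j => if i = j then (Δ i)⁻¹ else 0) *
      blockMat T (fun i j => if i = j then Δ i else 0) = 1 := by
    rw [blockMat_mul, ← blockMat_one]
    ext p q
    have : ∑ m ∈ T, (if (p.1 : ℕ) = m then (Δ p.1)⁻¹ else 0) * (if m = (q.1 : ℕ) then Δ m else 0) =
        if (p.1 : ℕ) = q.1 then (1 : Matrix (Fin d) (Fin d) ℝ) else 0 := by
      simp only [ite_mul, zero_mul, Finset.sum_ite_eq, p.1.2, if_true]
      split_ifs with h
      · exact Matrix.nonsing_inv_mul _ (isUnit_iff_ne_zero.2 (hdet p.1 p.1.2))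
      · simp
    exact congrFun (congrFun this p.2) q.2
  -- From Δ⁻¹(BΣBᵀ) = 1, the factor Bᵀ moves to the front because one-sided inverses of square
  -- matrices are two-sided; invertibility of B need not be shown separately.
  rw [← h1, ← Matrix.mul_assoc, ← Matrix.mul_assoc, mul_eq_one_comm, ← Matrix.mul_assoc,
    ← Matrix.mul_assoc, blockMat_transpose, blockMat_mul, blockMat_mul] at h2
  convert h2 using 3
  ext k l : 2
  refine Finset.sum_congr rfl fun m hm => ?_
  simp only [mul_ite, mul_zero, Finset.sum_ite_eq', hm, if_true]

end Whitening

/-! ### The precision blocks of the innovation form -/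

section Model

variable {Ω : Type*} [mΩ : MeasurableSpace Ω] {μ : Measure Ω} {d N c : ℕ}

/-- The blocks of the transformation `x ↦ (x c, (x m - D m x c - F m x (m - 1))_{m ≠ c})`. -/
def innovationBlock (c : ℕ) (F D : ℕ → Matrix (Fin d) (Fin d) ℝ) (m l : ℕ) :
    Matrix (Fin d) (Fin d) ℝ :=
  if l = m then 1 else if m = c then 0 else if l = c then -D m else if l + 1 = m then -F m else 0

/-- The blocks of the precision matrix of a sequence with innovations of covariances `Δ`. -/
noncomputable def precisionBlock (N c : ℕ) (F D Δ : ℕ → Matrix (Fin d) (Fin d) ℝ) (k l : ℕ) :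
    Matrix (Fin d) (Fin d) ℝ :=
  ∑ m ∈ Finset.Icc 0 N, (innovationBlock c F D m k).transpose * (Δ m)⁻¹ * innovationBlock c F D m l

/-- Away from column `c`, row `m` of the transformation is supported on the columns `m - 1` and `m`,
so no row meets both `k` and `l`. -/
theorem precisionBlock_eq_zero {F D Δ : ℕ → Matrix (Fin d) (Fin d) ℝ} {k l : ℕ} (hk : k ≠ c)
    (hl : l ≠ c) (hkl : k + 1 < l) : precisionBlock N c F D Δ k l = 0 := by
  refine Finset.sum_eq_zero fun m _ => ?_
  by_cases hm : m = k ∨ m = k + 1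
  · have : innovationBlock c F D m l = 0 := by
      unfold innovationBlock
      split_ifs <;> first | rfl | (exfalso; omega)
    rw [this, mul_zero]
  · have : innovationBlock c F D m k = 0 := by
      unfold innovationBlock
      split_ifs <;> first | rfl | (exfalso; omega)
    rw [this, Matrix.transpose_zero, zero_mul, zero_mul]

/-- Only the innovations at `k` and `k + 1` can involve `x k`. The second is absent when `k` is the
last time or when `k + 1 = c`, since row `c` just copies `x c`. -/
theorem precisionBlock_right {F D Δ : ℕ → Matrix (Fin d) (Fin d) ℝ} {k : ℕ} (hk : k ≠ c)
    (hkN : k ≤ N) : precisionBlock N c F D Δ k c =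
      -((Δ k)⁻¹ * D k) + if k + 1 ≤ N ∧ k + 1 ≠ c then
        (F (k + 1)).transpose * (Δ (k + 1))⁻¹ * D (k + 1) else 0 := by
  have hterm : ∀ m, (innovationBlock c F D m k).transpose * (Δ m)⁻¹ * innovationBlock c F D m c =
      (if m = k then -((Δ m)⁻¹ * D m) else 0) + if m = k + 1 then if m ≠ c then
        (F m).transpose * (Δ m)⁻¹ * D m else 0 else 0 := by
    intro m
    unfold innovationBlock
    by_cases h1 : m = k
    · subst h1
      simp [hk, Ne.symm hk]
    · by_cases h2 : m = c
      · subst h2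
        simp [hk, h1]
      · by_cases h3 : m = k + 1
        · subst h3
          simp [hk, h2, Ne.symm h2]
        · simp [hk, h1, Ne.symm h1, h2, h3, Ne.symm h3]
  unfold precisionBlock
  rw [Finset.sum_congr rfl fun m _ => hterm m, Finset.sum_add_distrib, Finset.sum_ite_eq',
    Finset.sum_ite_eq', if_pos (by simpa using hkN)]
  congr 1
  simp only [Finset.mem_Icc, zero_le, true_and]
  split_ifs <;> simp_all

theorem precisionBlock_right_eq_zero_iff {F D Δ : ℕ → Matrix (Fin d) (Fin d) ℝ} {k : ℕ}
    (hk : k ≠ c) (hkN : k + 1 ≤ N) (hkc : k + 1 ≠ c) : precisionBlock N c F D Δ k c = 0 ↔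
      (Δ k)⁻¹ * D k = (F (k + 1)).transpose * (Δ (k + 1))⁻¹ * D (k + 1) := by
  rw [precisionBlock_right hk (by omega), if_pos ⟨hkN, hkc⟩, neg_add_eq_zero]

/-- Hypothesis `hF` rules out two degenerate cases: `m - 1 = c`, where `innovationBlock` keeps only
`-D m` in that column, and `m = 0`, where `m - 1` truncates to 0. In both, `F m` must be zero. -/
theorem sum_innovationBlock {F D : ℕ → Matrix (Fin d) (Fin d) ℝ} (hc : c ≤ N) {m : ℕ}
    (hm : m ≤ N) (hmc : m ≠ c) (hF : F m = 0 ∨ (1 ≤ m ∧ m - 1 ≠ c)) (v : ℕ → Fin d → ℝ) :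
    ∑ l ∈ Finset.Icc 0 N, (innovationBlock c F D m l).mulVec (v l) =
      v m - (D m).mulVec (v c) - (F m).mulVec (v (m - 1)) := by
  have hterm : ∀ l, (innovationBlock c F D m l).mulVec (v l) =
      (if l = m then v l else 0) + (if l = c then -(D m).mulVec (v l) else 0) +
        if l = m - 1 then -(F m).mulVec (v l) else 0 := by
    intro l
    unfold innovationBlock
    rcases hF with hF | ⟨h1, h2⟩
    · rw [hF]
      by_cases h3 : l = m
      · subst h3
        simp [hmc]
      · by_cases h4 : l = c
        · simp [h4, hmc, Ne.symm hmc, Matrix.neg_mulVec]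
        · simp [h3, h4, hmc]
    · by_cases h3 : l = m
      · subst h3
        have : l ≠ l - 1 := by omega
        simp [hmc, this]
      · by_cases h4 : l = c
        · subst h4
          simp [h3, hmc, h2.symm, Matrix.neg_mulVec]
        · by_cases h5 : l + 1 = m
          · subst h5
            simp [h4, hmc, Matrix.neg_mulVec]
          · have : l ≠ m - 1 := by omega
            simp [h3, h4, hmc, h5, this]
  rw [Finset.sum_congr rfl fun l _ => hterm l, Finset.sum_add_distrib, Finset.sum_add_distrib,
    Finset.sum_ite_eq', Finset.sum_ite_eq', Finset.sum_ite_eq', if_pos (by simpa using hm),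
    if_pos (by simpa using hc), if_pos (by simp; omega)]
  abel

end Model

/-! ### Gaussianity, mean and precision of the constructed sequence -/

section InnovationModel

variable {Ω : Type*} [mΩ : MeasurableSpace Ω] {μ : Measure Ω} {d N c : ℕ}
  {x y e : ℕ → Ω → Fin d → ℝ} {F Γ U : ℕ → Matrix (Fin d) (Fin d) ℝ}

/-- The sequence `y k + Γ k x_c`, completed by `x_c`, is jointly Gaussian. -/
theorem hasGaussianLaw_seqCoord
    (hjoint : HasGaussianLaw
      (fun ω => ((fun k : (Finset.Icc 0 N \ {c} : Finset ℕ) => y k ω), x c ω)) μ)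
    (hx : ∀ k ∈ Finset.Icc 0 N \ {c}, ∀ᵐ ω ∂μ, x k ω = y k ω + (Γ k).mulVec (x c ω)) :
    HasGaussianLaw (fun ω p => seqCoord (Finset.Icc 0 N) x p ω) μ := by
  classical
  let L : (((Finset.Icc 0 N \ {c} : Finset ℕ) → Fin d → ℝ) × (Fin d → ℝ)) →ₗ[ℝ]
      (Finset.Icc 0 N × Fin d → ℝ) := LinearMap.pi fun p =>
    if hp : (p.1 : ℕ) ∈ Finset.Icc 0 N \ {c} then
      LinearMap.proj (R := ℝ) (φ := fun _ : Fin d => ℝ) p.2 ∘ₗ (LinearMap.proj (R := ℝ)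
        (φ := fun _ : (Finset.Icc 0 N \ {c} : Finset ℕ) => Fin d → ℝ) ⟨p.1, hp⟩ ∘ₗ
        LinearMap.fst ℝ _ _ + (Γ p.1).mulVecLin ∘ₗ LinearMap.snd ℝ _ _)
    else LinearMap.proj (R := ℝ) (φ := fun _ : Fin d => ℝ) p.2 ∘ₗ LinearMap.snd ℝ _ _
  refine (hjoint.map_fun L.toContinuousLinearMap).congr ?_
  have hall : ∀ᵐ ω ∂μ, ∀ k : (Finset.Icc 0 N \ {c} : Finset ℕ),
      x k ω = y k ω + (Γ k).mulVec (x c ω) := ae_all_iff.2 fun k => hx k k.2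
  filter_upwards [hall] with ω hω
  ext p
  simp only [LinearMap.coe_toContinuousLinearMap', L, LinearMap.pi_apply]
  by_cases hp : (p.1 : ℕ) ∈ Finset.Icc 0 N \ {c}
  · rw [dif_pos hp]
    exact (congrFun (hω ⟨p.1, hp⟩) p.2).symm
  · rw [dif_neg hp]
    have : (p.1 : ℕ) = c := by
      by_contra hne
      exact hp (by simp [hne])
    simp [seqCoord, this]

theorem crossCov_comm_eq_zero {X Y : Ω → Fin d → ℝ} (h : crossCov μ X Y = 0) :
    crossCov μ Y X = 0 := by
  ext i j
  have := congrFun (congrFun h j) i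
  simpa [crossCov, covariance_comm] using this

/-- A vector uncorrelated with `y` is uncorrelated with the innovations of `y`. -/
theorem crossCov_innovation_eq_zero [IsFiniteMeasure μ] {z y₀ y₁ e₁ : Ω → Fin d → ℝ}
    {G : Matrix (Fin d) (Fin d) ℝ} (hz : ∀ i, MemLp (fun ω => z ω i) 2 μ)
    (hy₁ : ∀ i, MemLp (fun ω => y₁ ω i) 2 μ) (h₁ : crossCov μ z y₁ = 0)
    (hG : G = 0 ∨ ((∀ i, MemLp (fun ω => y₀ ω i) 2 μ) ∧ crossCov μ z y₀ = 0))
    (hmodel : ∀ᵐ ω ∂μ, y₁ ω = G.mulVec (y₀ ω) + e₁ ω) : crossCov μ z e₁ = 0 := by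
  ext i j
  have h1 : cov[fun ω => z ω i, fun ω => y₁ ω j; μ] = 0 := congrFun (congrFun h₁ i) j
  change cov[fun ω => z ω i, fun ω => e₁ ω j; μ] = 0
  rcases hG with rfl | ⟨hy₀, h₀⟩
  · rw [← h1]
    refine covariance_congr_ae Filter.EventuallyEq.rfl ?_
    filter_upwards [hmodel] with ω hω
    simp [hω]
  · have hterm : ∀ l, MemLp (fun ω => G j l * y₀ ω l) 2 μ := fun l => (hy₀ l).const_mul _
    have he : (fun ω => e₁ ω j) =ᵐ[μ] fun ω => y₁ ω j - ∑ l, G j l * y₀ ω l := by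
      filter_upwards [hmodel] with ω hω
      simp [hω, Matrix.mulVec, dotProduct]
    rw [covariance_congr_ae Filter.EventuallyEq.rfl he,
      covariance_fun_sub_right (hz i) (hy₁ j) (memLp_finsetSum _ fun l _ => hterm l), h1,
      covariance_fun_sum_right hterm (hz i), zero_sub, neg_eq_zero]
    refine Finset.sum_eq_zero fun l _ => ?_
    have h2 : cov[fun ω => z ω i, fun ω => y₀ ω l; μ] = 0 := congrFun (congrFun h₀ i) l
    rw [covariance_const_mul_right, h2, mul_zero]

/-- The precision matrix of `x k = y k + Γ k x_c` in terms of the model of `y`. -/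
theorem precision_of_model [IsProbabilityMeasure μ] (hc : c ≤ N)
    (hF : ∀ m ∈ Finset.Icc 0 N \ {c}, F m = 0 ∨ (1 ≤ m ∧ m - 1 ≠ c))
    (hymodel : ∀ m ∈ Finset.Icc 0 N \ {c},
      ∀ᵐ ω ∂μ, y m ω = (F m).mulVec (y (m - 1) ω) + e m ω)
    (he : IsWhiteZMNG μ (Finset.Icc 0 N \ {c}) e U) (hxc : IsZMNG μ {c} x)
    (hjoint : HasGaussianLaw
      (fun ω => ((fun k : (Finset.Icc 0 N \ {c} : Finset ℕ) => y k ω), x c ω)) μ)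
    (huncorr : ∀ k ∈ Finset.Icc 0 N \ {c}, crossCov μ (x c) (y k) = 0)
    (hx : ∀ k ∈ Finset.Icc 0 N \ {c}, ∀ᵐ ω ∂μ, x k ω = y k ω + (Γ k).mulVec (x c ω)) :
    blockMat (Finset.Icc 0 N) (precisionBlock N c F (fun m => Γ m - F m * Γ (m - 1))
      fun m => if m = c then crossCov μ (x c) (x c) else U m) *
      seqCov μ (Finset.Icc 0 N) x = 1 := by
  have hmem : ∀ {m}, m ∈ Finset.Icc 0 N → m ≠ c → m ∈ Finset.Icc 0 N \ {c} := fun hm hmc => by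
    simpa [hmc] using hm
  have hyL : ∀ k ∈ Finset.Icc 0 N \ {c}, ∀ i, MemLp (fun ω => y k ω i) 2 μ := fun k hk i =>
    ((hjoint.fst.eval ⟨k, hk⟩).eval i).memLp_two
  have hzL : ∀ i, MemLp (fun ω => x c ω i) 2 μ := fun i => (hjoint.snd.eval i).memLp_two
  have hpred : ∀ m ∈ Finset.Icc 0 N \ {c}, F m = 0 ∨ m - 1 ∈ Finset.Icc 0 N \ {c} :=
    fun m hm => (hF m hm).imp_right fun h => by
      simp only [Finset.mem_sdiff, Finset.mem_Icc, Finset.mem_singleton] at hm ⊢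
      omega
  have hze : ∀ m ∈ Finset.Icc 0 N \ {c}, crossCov μ (x c) (e m) = 0 := fun m hm =>
    crossCov_innovation_eq_zero hzL (hyL m hm) (huncorr m hm)
      ((hpred m hm).imp_right fun h => ⟨hyL _ h, huncorr _ h⟩) (hymodel m hm)
  -- The definition of `D` makes the `x c` terms cancel, so the transformed vector at `m ≠ c` is `y
  -- m - F m y (m - 1) = e m`; it is uncorrelated with `x c` by `hze`.
  refine precision_of_whitening (w := fun m => if m = c then x c else e m)
    (fun p => ((hasGaussianLaw_seqCoord hjoint hx).eval p).memLp_two) (fun m hm => ?_)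
    (fun i hi j hj => ?_) fun i hi => ?_
  · by_cases hmc : m = c
    · subst hmc
      refine Filter.Eventually.of_forall fun ω => ?_
      rw [if_pos rfl, Finset.sum_eq_single_of_mem m hm fun l _ hl => by
        simp [innovationBlock, hl]]
      simp [innovationBlock]
    · have hm' := hmem hm hmc
      have hprev : F m = 0 ∨ ∀ᵐ ω ∂μ, x (m - 1) ω = y (m - 1) ω + (Γ (m - 1)).mulVec (x c ω) :=
        (hpred m hm').imp_right fun h => hx _ h
      have hprev' : ∀ᵐ ω ∂μ, (F m).mulVec (x (m - 1) ω) =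
          (F m).mulVec (y (m - 1) ω + (Γ (m - 1)).mulVec (x c ω)) := by
        rcases hprev with h | h
        · simp [h]
        · exact h.mono fun ω hω => by rw [hω]
      filter_upwards [hx m hm', hymodel m hm', hprev'] with ω h1 h2 h3
      rw [if_neg hmc, sum_innovationBlock hc (Finset.mem_Icc.1 hm).2 hmc (hF m hm')
        (fun l => x l ω), h3, h1, h2, Matrix.mulVec_add, Matrix.mulVec_mulVec, Matrix.sub_mulVec]
      abel
  · by_cases hic : i = c <;> by_cases hjc : j = c
    · simp [hic, hjc]
    · simp [hic, hjc, Ne.symm hjc, hze j (hmem hj hjc)]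
    · simp [hic, hjc, crossCov_comm_eq_zero (hze i (hmem hi hic))]
    · by_cases hij : i = j
      · subst hij
        simp [hic, he.cov_eq i (hmem hi hic)]
      · simp [hic, hjc, hij, he.white i (hmem hi hic) j (hmem hj hjc) hij]
  · by_cases hic : i = c
    · rw [if_pos hic]
      exact det_crossCov_ne_zero hxc.nonsingular
        (fun k hk l hl hkl => absurd ((Finset.mem_singleton.1 hk).trans
          (Finset.mem_singleton.1 hl).symm) hkl) (Finset.mem_singleton_self c)
    · rw [if_neg hic, ← he.cov_eq i (hmem hi hic)]
      exact det_crossCov_ne_zero he.zmng.nonsingular he.white (hmem hi hic)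

theorem integral_seqCoord_eq_zero [IsProbabilityMeasure μ]
    (hy : IsZMNG μ (Finset.Icc 0 N \ {c}) y) (hxc : IsZMNG μ {c} x)
    (hx : ∀ k ∈ Finset.Icc 0 N \ {c}, ∀ᵐ ω ∂μ, x k ω = y k ω + (Γ k).mulVec (x c ω))
    (p : Finset.Icc 0 N × Fin d) : ∫ ω, seqCoord (Finset.Icc 0 N) x p ω ∂μ = 0 := by
  have hz : HasGaussianLaw (x c) μ :=
    hxc.gaussian.eval (⟨c, Finset.mem_singleton_self c⟩ : ({c} : Finset ℕ))
  have hz0 : ∀ i, ∫ ω, x c ω i ∂μ = 0 := fun i => by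
    rw [← eval_integral fun i => (hz.eval i).integrable,
      hxc.mean_zero c (Finset.mem_singleton_self c)]
    rfl
  by_cases hp : (p.1 : ℕ) = c
  · simp only [seqCoord, hp, hz0]
  · have hp' : (p.1 : ℕ) ∈ Finset.Icc 0 N \ {c} := by simp [hp]
    have hyG : HasGaussianLaw (y p.1) μ :=
      hy.gaussian.eval (⟨p.1, hp'⟩ : (Finset.Icc 0 N \ {c} : Finset ℕ))
    have hy0 : ∫ ω, y p.1 ω p.2 ∂μ = 0 := by
      rw [← eval_integral fun i => (hyG.eval i).integrable, hy.mean_zero p.1 hp']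
      rfl
    have hterm : ∀ j, Integrable (fun ω => Γ p.1 p.2 j * x c ω j) μ := fun j =>
      (hz.eval j).integrable.const_mul _
    have heq : (fun ω => seqCoord (Finset.Icc 0 N) x p ω) =ᵐ[μ]
        fun ω => y p.1 ω p.2 + ∑ j, Γ p.1 p.2 j * x c ω j := by
      filter_upwards [hx p.1 hp'] with ω hω
      simp [seqCoord, hω, Matrix.mulVec, dotProduct]
    rw [integral_congr_ae heq, integral_add (hyG.eval p.2).integrable
      (integrable_finsetSum _ fun j _ => hterm j), integral_finsetSum _ fun j _ => hterm j, hy0]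
    simp [integral_const_mul, hz0]

end InnovationModel

/-! ### The characterization -/

/-- Here `U k` is the noise covariance `U_k`, `M k (k - 1)` is the transition matrix `U_{k,k-1}`,
and all time sets are subsets of `[0, N]`; values of the sequences at other times play no role. -/
theorem mainTheorem4 {Ω : Type*} [MeasurableSpace Ω] (μ : Measure Ω) [IsProbabilityMeasure μ]
    (N d : ℕ) (hN : 2 ≤ N) (c a r : ℕ)
    (hcar : (c = 0 ∧ a = 1 ∧ r = 1) ∨ (c = N ∧ a = N ∧ r = N - 1))
    (x y e : ℕ → Ω → Fin d → ℝ)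
    (U : ℕ → Matrix (Fin d) (Fin d) ℝ)
    (M : ℕ → ℕ → Matrix (Fin d) (Fin d) ℝ)
    (Γ : ℕ → Matrix (Fin d) (Fin d) ℝ)
    (hxm : ∀ k ∈ Finset.Icc 0 N, Measurable (x k))
    (hym : ∀ k ∈ Finset.Icc 0 N \ {c}, Measurable (y k))
    -- the sequence `y` without `y c` is zero-mean nonsingular Gaussian and Markov
    (hy : IsZMNG μ (Finset.Icc 0 N \ {c}) y)
    (hyMarkov : IsMarkovSeq μ (Finset.Icc 0 N \ {c}) y)
    -- its Markov model
    (hymodel : ∀ k ∈ Finset.Icc 1 N \ {a},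
      ∀ᵐ ω ∂μ, y k ω = (M k (k - 1)).mulVec (y (k - 1) ω) + e k ω)
    (hy0 : c = N → e 0 =ᵐ[μ] y 0)
    (hy1 : c = 0 → e 1 =ᵐ[μ] y 1)
    (he : IsWhiteZMNG μ (Finset.Icc 0 N \ {c}) e U)
    -- the vector `x c`: zero-mean nonsingular Gaussian, jointly Gaussian and uncorrelated with `y`
    (hxc : IsZMNG μ {c} x)
    (hjoint : HasGaussianLaw
      (fun ω => ((fun k : (Finset.Icc 0 N \ {c} : Finset ℕ) => y k ω), x c ω)) μ)
    (huncorr : ∀ k ∈ Finset.Icc 0 N \ {c}, crossCov μ (x c) (y k) = 0)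
    -- the construction of `x`
    (hx : ∀ k ∈ Finset.Icc 0 N \ {c}, ∀ᵐ ω ∂μ, x k ω = y k ω + (Γ k).mulVec (x c ω)) :
    (IsReciprocalSeq μ (Finset.Icc 0 N) x ↔
      ∀ k ∈ Finset.Icc 1 (N - 1) \ {r},
        (U k)⁻¹ * (Γ k - M k (k - 1) * Γ (k - 1)) =
          (M (k + 1) k).transpose * (U (k + 1))⁻¹ * (Γ (k + 1) - M (k + 1) k * Γ k)) ∧
    (IsMarkovSeq μ (Finset.Icc 0 N) x ↔
      (∀ k ∈ Finset.Icc 1 (N - 1) \ {r},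
        (U k)⁻¹ * (Γ k - M k (k - 1) * Γ (k - 1)) =
          (M (k + 1) k).transpose * (U (k + 1))⁻¹ * (Γ (k + 1) - M (k + 1) k * Γ k)) ∧
      (c = N → (U 0)⁻¹ * Γ 0 = (M 1 0).transpose * (U 1)⁻¹ * (Γ 1 - M 1 0 * Γ 0)) ∧
      (c = 0 → Γ N - M N (N - 1) * Γ (N - 1) = 0)) := by
  classical
  -- Setting `F` to zero at the initial time of `y` (0 if `c = N`, and `a = 1` if `c = 0`) turns the
  -- initial condition into an instance of the recursion.
  let F : ℕ → Matrix (Fin d) (Fin d) ℝ := fun m =>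
    if m ∈ Finset.Icc 1 N \ {a} then M m (m - 1) else 0
  let D : ℕ → Matrix (Fin d) (Fin d) ℝ := fun m => Γ m - F m * Γ (m - 1)
  let Δ : ℕ → Matrix (Fin d) (Fin d) ℝ := fun m => if m = c then crossCov μ (x c) (x c) else U m
  have hc : c ≤ N := by omega
  have hFpos : ∀ m, 1 ≤ m → m ≤ N → m ≠ a → F m = M m (m - 1) := fun m h1 h2 h3 =>
    if_pos (by simp only [Finset.mem_sdiff, Finset.mem_Icc, Finset.mem_singleton]; omega)
  have hFneg : ∀ m, m = 0 ∨ m = a → F m = 0 := fun m h =>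
    if_neg (by simp only [Finset.mem_sdiff, Finset.mem_Icc, Finset.mem_singleton]; omega)
  have hF : ∀ m ∈ Finset.Icc 0 N \ {c}, F m = 0 ∨ (1 ≤ m ∧ m - 1 ≠ c) := by
    intro m hm
    simp only [Finset.mem_sdiff, Finset.mem_Icc, Finset.mem_singleton] at hm
    by_cases h : m = 0 ∨ m = a
    · exact Or.inl (hFneg m h)
    · right
      omega
  have hmodel : ∀ m ∈ Finset.Icc 0 N \ {c},
      ∀ᵐ ω ∂μ, y m ω = (F m).mulVec (y (m - 1) ω) + e m ω := by
    intro m hm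
    simp only [Finset.mem_sdiff, Finset.mem_Icc, Finset.mem_singleton] at hm
    by_cases h : m = 0 ∨ m = a
    · have hey : e m =ᵐ[μ] y m := by
        rcases hcar with ⟨h1, h2, -⟩ | ⟨h1, h2, -⟩
        · obtain rfl : m = 1 := by omega
          exact hy1 h1
        · obtain rfl : m = 0 := by omega
          exact hy0 h1
      filter_upwards [hey] with ω hω
      rw [hFneg m h, hω, Matrix.zero_mulVec, zero_add]
    · rw [hFpos m (by omega) hm.1.2 (by omega)]
      exact hymodel m (by
        simp only [Finset.mem_sdiff, Finset.mem_Icc, Finset.mem_singleton]; omega)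
  have hb : blockMat (Finset.Icc 0 N) (precisionBlock N c F D Δ) *
      seqCov μ (Finset.Icc 0 N) x = 1 :=
    precision_of_model hc hF hmodel he hxc hjoint huncorr hx
  have hG := hasGaussianLaw_seqCoord hjoint hx
  have h0 := integral_seqCoord_eq_zero hy hxc hx
  -- The blocks are computed in column `c`, whereas for `c = 0` the blocks above the diagonal lie in
  -- row `c`; symmetry of the precision matrix converts.
  have hflip : ∀ k, k ≤ N →
      (precisionBlock N c F D Δ c k = 0 ↔ precisionBlock N c F D Δ k c = 0) := by
    intro k hk
    rw [block_transpose_of_mul_seqCov_eq_one hb (k := k) (l := c) (by simpa using hk)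
      (by simpa using hc), Matrix.transpose_eq_zero]
  have hD : ∀ m, 1 ≤ m → m ≤ N → m ≠ a → D m = Γ m - M m (m - 1) * Γ (m - 1) :=
    fun m h1 h2 h3 => by simp only [D, hFpos m h1 h2 h3]
  have hD0 : D 0 = Γ 0 := by simp [D, hFneg 0 (Or.inl rfl)]
  have hΔ : ∀ m, m ≠ c → Δ m = U m := fun m hm => if_neg hm
  have hcond : ∀ k, 1 ≤ k → k + 1 ≤ N → k ≠ c → k + 1 ≠ c → k ≠ a → k + 1 ≠ a →
      (precisionBlock N c F D Δ k c = 0 ↔ (U k)⁻¹ * (Γ k - M k (k - 1) * Γ (k - 1)) =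
        (M (k + 1) k).transpose * (U (k + 1))⁻¹ * (Γ (k + 1) - M (k + 1) k * Γ k)) := by
    intro k h1 h2 h3 h4 h5 h6
    rw [precisionBlock_right_eq_zero_iff h3 h2 h4, hΔ k h3, hΔ (k + 1) h4,
      hD k h1 (by omega) h5, hD (k + 1) (by omega) h2 h6, hFpos (k + 1) (by omega) h2 h6,
      Nat.add_sub_cancel]
  rw [isReciprocalSeq_iff_precision hxm hG h0 hb, isMarkovSeq_iff_precision hxm hG h0 hb]
  rcases hcar with ⟨rfl, rfl, rfl⟩ | ⟨hcN, haN, rfl⟩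
  -- Time `N` has no successor, so the corner block is `-(U N)⁻¹ * D N`, and the invertible `U N`
  -- cancels.
  · have hlast : precisionBlock N 0 F D Δ N 0 = 0 ↔ Γ N - M N (N - 1) * Γ (N - 1) = 0 := by
      have hu : IsUnit (U N).det := by
        rw [← he.cov_eq N (by simp; omega)]
        exact isUnit_iff_ne_zero.2
          (det_crossCov_ne_zero he.zmng.nonsingular he.white (by simp; omega))
      rw [precisionBlock_right (by omega) le_rfl, if_neg (by omega), add_zero, neg_eq_zero,
        hΔ N (by omega), hD N (by omega) le_rfl (by omega)]
      refine ⟨fun h => ?_, fun h => by rw [h, mul_zero]⟩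
      rw [← Matrix.mul_nonsing_inv_cancel_left (U N) (Γ N - M N (N - 1) * Γ (N - 1)) hu, h,
        mul_zero]
    have hrec : (∀ k l, k + 1 < l → l ≤ N → ¬(k = 0 ∧ l = N) →
        precisionBlock N 0 F D Δ k l = 0) ↔ ∀ k ∈ Finset.Icc 1 (N - 1) \ {1},
        (U k)⁻¹ * (Γ k - M k (k - 1) * Γ (k - 1)) =
          (M (k + 1) k).transpose * (U (k + 1))⁻¹ * (Γ (k + 1) - M (k + 1) k * Γ k) := by
      constructor
      · intro h k hk
        simp only [Finset.mem_sdiff, Finset.mem_Icc, Finset.mem_singleton] at hk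
        exact (hcond k (by omega) (by omega) (by omega) (by omega) (by omega) (by omega)).1
          ((hflip k (by omega)).1 (h 0 k (by omega) (by omega) (by omega)))
      · intro h k l hkl hl hne
        by_cases hk : k = 0
        · subst hk
          exact (hflip l hl).2 ((hcond l (by omega) (by omega) (by omega) (by omega) (by omega)
            (by omega)).2 (h l (by
              simp only [Finset.mem_sdiff, Finset.mem_Icc, Finset.mem_singleton]; omega)))
        · exact precisionBlock_eq_zero hk (by omega) hkl
    refine ⟨hrec, ?_⟩
    -- Markov is reciprocal plus the vanishing of the corner block (0, N).
    rw [← hrec, ← hlast, ← hflip N le_rfl]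
    refine ⟨fun h => ⟨fun k l h1 h2 _ => h k l h1 h2, fun hN0 => by omega,
      fun _ => h 0 N (by omega) le_rfl⟩, fun h k l h1 h2 => ?_⟩
    by_cases hkl : k = 0 ∧ l = N
    · rw [hkl.1, hkl.2]
      exact h.2.2 rfl
    · exact h.1 k l h1 h2 hkl
  · obtain rfl := hcN.symm
    obtain rfl := haN.symm
    -- Here the corner lies in column `c = N`; since `F 0 = 0`, the term `D 0` is just `Γ 0`.
    have hfirst : precisionBlock N N F D Δ 0 N = 0 ↔
        (U 0)⁻¹ * Γ 0 = (M 1 0).transpose * (U 1)⁻¹ * (Γ 1 - M 1 0 * Γ 0) := by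
      rw [precisionBlock_right_eq_zero_iff (by omega) (by omega) (by omega), hΔ 0 (by omega),
        hΔ (0 + 1) (by omega), hD0, hD (0 + 1) (by omega) (by omega) (by omega),
        hFpos (0 + 1) (by omega) (by omega) (by omega)]
    have hrec : (∀ k l, k + 1 < l → l ≤ N → ¬(k = 0 ∧ l = N) →
        precisionBlock N N F D Δ k l = 0) ↔ ∀ k ∈ Finset.Icc 1 (N - 1) \ {N - 1},
        (U k)⁻¹ * (Γ k - M k (k - 1) * Γ (k - 1)) =
          (M (k + 1) k).transpose * (U (k + 1))⁻¹ * (Γ (k + 1) - M (k + 1) k * Γ k) := by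
      constructor
      · intro h k hk
        simp only [Finset.mem_sdiff, Finset.mem_Icc, Finset.mem_singleton] at hk
        exact (hcond k (by omega) (by omega) (by omega) (by omega) (by omega) (by omega)).1
          (h k N (by omega) le_rfl (by omega))
      · intro h k l hkl hl hne
        by_cases hlN : l = N
        · subst hlN
          exact (hcond k (by omega) (by omega) (by omega) (by omega) (by omega)
            (by omega)).2 (h k (by
              simp only [Finset.mem_sdiff, Finset.mem_Icc, Finset.mem_singleton]; omega))
        · exact precisionBlock_eq_zero (by omega) hlN hkl
    refine ⟨hrec, ?_⟩
    rw [← hrec, ← hfirst]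
    refine ⟨fun h => ⟨fun k l h1 h2 _ => h k l h1 h2, fun _ => h 0 N (by omega) le_rfl,
      fun hN0 => by omega⟩, fun h k l h1 h2 => ?_⟩
    by_cases hkl : k = 0 ∧ l = N
    · rw [hkl.1, hkl.2]
      exact h.2.1 rfl
    · exact h.1 k l h1 h2 hkl
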